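/- Let $F$ be the free group on a family $\{x_i \mid i\in I\}$, where $I$ is a nonempty (possibly infinite) set. Let $\varphi:F\to F$ be an automorphism such that $$\varphi(x_i)=w_i\,x_{\sigma(i)}\,w_i^{-1}\qquad\text{for all } i\in I,$$ where $w_i\in F$ and $\sigma:I\to I$ is a bijection. Assume that $\sigma(i_0)=i_0$ for some $i_0\in I$, and let $h:F\to\mathbb Z$ be the homomorphism with $h(x_{i_0})=1$ and $h(x_j)=0$ for all $j\neq i_0$. Assume that for every finite orbit $\mathcal O$ of $\sigma$ (an orbit being a set $\{\sigma^n(i)\mid n\in\mathbb Z\}$ with $i\in I$) $$\gcd\Big(|\mathcal O|,\ \sum_{i\in\mathcal O}h(w_i)\Big)=1.$$ Then there is a bi-ordering of $F$ invariant under $\varphi$: that is, a strict total ordering $<$ of $F$ such that, for all $f,g,k\in F$, $f<g$ implies $kf<kg$ and $fk<gk$, and such that $f<g$ if and only if $\varphi(f)<\varphi(g)$. -/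

import Mathlib

/-- A bi-ordering of a group `G`: a strict total ordering invariant under left and right
multiplication. -/
structure IsBiOrdering {G : Type*} [Group G] (lt : G → G → Prop) : Prop where
  isStrictTotalOrder : IsStrictTotalOrder G lt
  mul_left : ∀ f g h : G, lt f g → lt (h * f) (h * g)
  mul_right : ∀ f g h : G, lt f g → lt (f * h) (g * h)

/-- A relation `lt` on `G` is invariant under the automorphism `φ`. -/
def IsInvariantUnder {G : Type*} [Group G] (lt : G → G → Prop) (φ : G ≃* G) : Prop :=
  ∀ f g : G, lt f g ↔ lt (φ f) (φ g)

/-- The orbit `{σ ^ n (x) | n ∈ ℤ}` of `x` under the bijection `σ`. -/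
def permOrbit {I : Type*} (σ : Equiv.Perm I) (x : I) : Set I :=
  {y | ∃ n : ℤ, y = (σ ^ n) x}

open Classical in
/-- The homomorphism `F → ℤ` that sends the basis element `x i₀` to `1` and every other basis
element to `0`; the group `ℤ` is written multiplicatively. -/
noncomputable def expHom {I F : Type*} [Group F] (x : FreeGroupBasis I F) (i₀ : I) :
    F →* Multiplicative ℤ :=
  FreeGroupBasis.lift x (fun j => Multiplicative.ofAdd (if j = i₀ then (1 : ℤ) else 0))

/-- The value in `ℤ` of the homomorphism `expHom x i₀` at `w`. -/
noncomputable def expCount {I F : Type*} [Group F] (x : FreeGroupBasis I F) (i₀ : I) (w : F) : ℤ :=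
  Multiplicative.toAdd (expHom x i₀ w)

/-!
The kernel `K` of `h = expHom x i₀` is free on the elements `x i₀ ^ n * x j * (x i₀ ^ n)⁻¹` with
`j ≠ i₀` and `n : ℤ` (`kernelHom_injective`, `exists_kernelHom_mul_zpow`, from a comparison of `F`
with a semidirect product). Since `h ∘ φ = h`, it is enough to find a bi-ordering of `K` that is
invariant under conjugation by `F` and under `φ`: then `F` is ordered by first comparing values
of `h`.

Both kinds of automorphism send the generator `(j, n)` of `K` to a conjugate, by an element of
`K`, of another generator: conjugation by `g` permutes the generators by `(j, n) ↦ (j, n + h g)`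
and `φ` permutes them by `(j, n) ↦ (σ j, n + h (w j))`. These permutations generate an action of
`ℤ × ℤ`. The stabilizer of `(j, n)` is trivial if the orbit of `j` under `σ` is infinite, and is
generated by `(-C, d)` if the orbit has `d` elements and `C` is the sum of `h (w i)` over it. In
the second case the condition `gcd (d, C) = 1` makes the quotient by the stabilizer torsion-free,
so that it can be ordered. Hence the set of generators has a linear order that is preserved by the
whole action (`exists_linearOrder_skewPerm`).

It remains to order a free group on a linearly ordered set `S` so that every endomorphism taking
each `s` to a conjugate of `π s`, for a strictly monotone permutation `π` of `S`, preserves the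
order. This is done by the Magnus expansion `s ↦ 1 + X s` into noncommutative power series: an
element is positive if the first nonempty word of its expansion, in the order by length and then
lexicographic, has a positive coefficient. The expansion is injective (`exists_magnus_ne_zero`) and
has finitely many terms in each degree (`finite_support_magnus`), which makes the order total. An
endomorphism as above acts on the leading form of the expansion by applying `π` to each letter
(`leading_form_apply`), which gives the invariance (`NCSeries.IsPos.map`).
-/

/-! ### Noncommutative power series -/

/-- Formal power series with integer coefficients in noncommuting variables indexed by `S`: a
monomial is a word in `S`, and a series is the family of its coefficients. -/
def NCSeries (S : Type*) : Type _ := List S → ℤ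

namespace NCSeries

variable {S : Type*}

instance : AddCommGroup (NCSeries S) := inferInstanceAs (AddCommGroup (List S → ℤ))

@[ext] theorem ext {f g : NCSeries S} (h : ∀ w, f w = g w) : f = g := funext h

@[simp] theorem zero_apply (w : List S) : (0 : NCSeries S) w = 0 := rfl
@[simp] theorem add_apply (f g : NCSeries S) (w : List S) : (f + g) w = f w + g w := rfl
@[simp] theorem neg_apply (f : NCSeries S) (w : List S) : (-f) w = -f w := rfl
@[simp] theorem zsmul_apply (c : ℤ) (f : NCSeries S) (w : List S) : (c • f) w = c * f w := rfl
@[simp] theorem sub_apply (f g : NCSeries S) (w : List S) : (f - g) w = f w - g w := rfl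

/-- The coefficient of the Cauchy product, by recursion on the word: in a factorization of `a :: w`
the left factor is either empty or begins with `a`. -/
def conv : List S → (List S → ℤ) → (List S → ℤ) → ℤ
  | [], f, g => f [] * g []
  | a :: w, f, g => f [] * g (a :: w) + conv w (fun v => f (a :: v)) g

instance : Mul (NCSeries S) := ⟨fun f g w => conv w f g⟩

/-- The series whose monomials are those of `f` that begin with `a`, with this letter removed. -/
def tail (a : S) (f : NCSeries S) : NCSeries S := fun w => f (a :: w)

@[simp] theorem tail_apply (a : S) (f : NCSeries S) (w : List S) : tail a f w = f (a :: w) := rfl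

@[simp] theorem mul_nil (f g : NCSeries S) : (f * g) [] = f [] * g [] := rfl

theorem mul_cons (f g : NCSeries S) (a : S) (w : List S) :
    (f * g) (a :: w) = f [] * g (a :: w) + (tail a f * g) w := rfl

instance : One (NCSeries S) := ⟨fun w => match w with | [] => 1 | _ :: _ => 0⟩

@[simp] theorem one_nil : (1 : NCSeries S) [] = 1 := rfl
@[simp] theorem one_cons (a : S) (w : List S) : (1 : NCSeries S) (a :: w) = 0 := rfl

theorem zero_mul' (g : NCSeries S) : 0 * g = 0 := by
  ext w
  induction w with
  | nil => simp
  | cons a w ih =>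
    rw [mul_cons]
    change 0 * _ + ((0 : NCSeries S) * g) w = _
    simp [ih]

theorem add_mul' (f f' g : NCSeries S) : (f + f') * g = f * g + f' * g := by
  ext w
  induction w generalizing f f' with
  | nil => simp [add_mul]
  | cons a w ih =>
    have h : tail a (f + f') = tail a f + tail a f' := rfl
    simp only [mul_cons, add_apply, h, ih]
    ring

theorem mul_add' (f g g' : NCSeries S) : f * (g + g') = f * g + f * g' := by
  ext w
  induction w generalizing f with
  | nil => simp [mul_add]
  | cons a w ih =>
    simp only [mul_cons, add_apply, ih]
    ring

theorem zsmul_mul' (c : ℤ) (f g : NCSeries S) : c • f * g = c • (f * g) := by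
  ext w
  induction w generalizing f with
  | nil => simp [mul_assoc]
  | cons a w ih =>
    have h : tail a (c • f) = c • tail a f := rfl
    simp only [mul_cons, zsmul_apply, h, ih]
    ring

theorem mul_assoc' (f g h : NCSeries S) : f * g * h = f * (g * h) := by
  ext w
  induction w generalizing f with
  | nil => simp [mul_assoc]
  | cons a w ih =>
    have e : tail a (f * g) = f [] • tail a g + tail a f * g := rfl
    rw [mul_cons, mul_cons, e, add_mul', add_apply, zsmul_mul', ih, mul_cons, mul_nil, zsmul_apply]
    ring

theorem one_mul' (f : NCSeries S) : 1 * f = f := by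
  ext w
  cases w with
  | nil => simp
  | cons a w =>
    have h : tail a (1 : NCSeries S) = 0 := rfl
    simp [mul_cons, h, zero_mul']

theorem mul_one' (f : NCSeries S) : f * 1 = f := by
  ext w
  induction w generalizing f with
  | nil => simp
  | cons a w ih => simp [mul_cons, ih]

instance : Ring (NCSeries S) :=
  { (inferInstance : AddCommGroup (NCSeries S)), (inferInstance : Mul (NCSeries S)),
    (inferInstance : One (NCSeries S)) with
    left_distrib := mul_add'
    right_distrib := add_mul'
    zero_mul := zero_mul'
    mul_zero := fun f => by
      have h := mul_add' f 0 0
      rwa [add_zero, left_eq_add] at h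
    mul_assoc := mul_assoc'
    one_mul := one_mul'
    mul_one := mul_one' }

/-! ### The degree filtration -/

/-- The series `f` has order at least `n`: no monomial of degree below `n` occurs in it. -/
def OrderGE (n : ℕ) (f : NCSeries S) : Prop := ∀ w : List S, w.length < n → f w = 0

theorem OrderGE.mul_apply_left {n : ℕ} {g : NCSeries S} (hg : OrderGE n g) (f : NCSeries S)
    {w : List S} (hw : w.length ≤ n) : (f * g) w = f [] * g w := by
  induction w generalizing f with
  | nil => simp
  | cons a w ih =>
    rw [List.length_cons] at hw
    rw [mul_cons, ih _ (by lia), hg w (by lia)]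
    simp

theorem OrderGE.mul_apply_right {n : ℕ} {f : NCSeries S} (hf : OrderGE n f) (g : NCSeries S)
    {w : List S} (hw : w.length ≤ n) : (f * g) w = f w * g [] := by
  induction w generalizing f n with
  | nil => simp
  | cons a w ih =>
    rw [List.length_cons] at hw
    obtain ⟨m, rfl⟩ : ∃ m, n = m + 1 := ⟨n - 1, by lia⟩
    have ht : OrderGE m (tail a f) := fun v hv => hf (a :: v) (by simpa using hv)
    rw [mul_cons, ih ht (by lia), hf [] (by simp)]
    simp

theorem OrderGE.mul {m n : ℕ} {f g : NCSeries S} (hf : OrderGE m f) (hg : OrderGE n g) :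
    OrderGE (m + n) (f * g) := by
  intro w hw
  induction w generalizing f m with
  | nil =>
    rw [mul_nil]
    rcases Nat.eq_zero_or_pos m with rfl | hm
    · rw [hg [] (by simpa using hw), mul_zero]
    · rw [hf [] (by simpa using hm), zero_mul]
  | cons a w ih =>
    rw [List.length_cons] at hw
    rw [mul_cons]
    rcases m with _ | m
    · rw [hg (a :: w) (by simp; lia), ih (m := 0) (fun v hv => by simp at hv) (by lia)]
      simp
    · have ht : OrderGE m (tail a f) := fun v hv => hf (a :: v) (by simpa using hv)
      rw [hf [] (by simp), ih ht (by lia)]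
      simp

theorem OrderGE.pow {f : NCSeries S} (hf : OrderGE 1 f) (n : ℕ) : OrderGE n (f ^ n) := by
  induction n with
  | zero => exact fun w hw => by simp at hw
  | succ n ih => rw [pow_succ]; exact ih.mul hf

theorem OrderGE.add {n : ℕ} {f g : NCSeries S} (hf : OrderGE n f) (hg : OrderGE n g) :
    OrderGE n (f + g) := fun w hw => by rw [add_apply, hf w hw, hg w hw, add_zero]

theorem OrderGE.neg {n : ℕ} {f : NCSeries S} (hf : OrderGE n f) : OrderGE n (-f) :=
  fun w hw => by rw [neg_apply, hf w hw, neg_zero]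

theorem OrderGE.mul_left {n : ℕ} {g : NCSeries S} (hg : OrderGE n g) (f : NCSeries S) :
    OrderGE n (f * g) := fun w hw => by rw [hg.mul_apply_left f hw.le, hg w hw, mul_zero]

theorem OrderGE.mul_right {n : ℕ} {f : NCSeries S} (hf : OrderGE n f) (g : NCSeries S) :
    OrderGE n (f * g) := fun w hw => by rw [hf.mul_apply_right g hw.le, hf w hw, zero_mul]

/-! ### Variables and the units `1 + X s` -/

open Classical in
/-- The variable `X s`: the monomial given by the one-letter word `s`. -/
noncomputable def X (s : S) : NCSeries S := fun w => if w = [s] then 1 else 0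

@[simp] theorem X_nil (s : S) : X s [] = 0 := by simp [X]

theorem X_orderGE (s : S) : OrderGE 1 (X s) := fun w hw => by
  rw [List.length_eq_zero_iff.1 (by lia : w.length = 0), X_nil]

theorem X_mul_cons_self (s : S) (f : NCSeries S) (w : List S) : (X s * f) (s :: w) = f w := by
  have h : tail s (X s) = 1 := by
    ext v
    cases v <;> simp [X]
  rw [mul_cons, h, one_mul, X_nil, zero_mul, zero_add]

theorem X_mul_cons_of_ne {s a : S} (h : a ≠ s) (f : NCSeries S) (w : List S) :
    (X s * f) (a :: w) = 0 := by
  have h : tail a (X s) = 0 := by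
    ext v
    simp [X, h]
  rw [mul_cons, h, zero_mul, X_nil, zero_mul, zero_apply, zero_add]

open Classical in
/-- The geometric series `1 - X s + (X s) ^ 2 - ⋯`. -/
noncomputable def geom (s : S) : NCSeries S :=
  fun w => if ∀ a ∈ w, a = s then (-1) ^ w.length else 0

theorem tail_geom_self (s : S) : tail s (geom s) = -geom s := by
  ext w
  have h : (∀ a ∈ s :: w, a = s) ↔ ∀ a ∈ w, a = s := by simp
  simp only [tail_apply, geom, neg_apply]
  by_cases hw : ∀ a ∈ w, a = s
  · rw [if_pos hw, if_pos (h.2 hw), List.length_cons, pow_succ, mul_neg_one]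
  · rw [if_neg hw, if_neg (mt h.1 hw), neg_zero]

theorem tail_geom_of_ne {s a : S} (h : a ≠ s) : tail a (geom s) = 0 := by
  ext w
  simp [geom, h]

@[simp] theorem geom_nil (s : S) : geom s [] = 1 := by simp [geom]

theorem one_add_X_mul_geom (s : S) : (1 + X s) * geom s = 1 := by
  ext w
  rw [add_mul, one_mul, add_apply]
  rcases w with _ | ⟨a, w⟩
  · simp
  · rw [← tail_apply a (geom s)]
    by_cases h : a = s
    · subst h
      rw [X_mul_cons_self, tail_geom_self]
      simp
    · rw [X_mul_cons_of_ne h, tail_geom_of_ne h]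
      simp

theorem geom_mul_one_add_X (s : S) : geom s * (1 + X s) = 1 := by
  ext w
  induction w with
  | nil => simp
  | cons a w ih =>
    rw [mul_cons]
    by_cases h : a = s
    · subst h
      rw [tail_geom_self, neg_mul, neg_apply, ih]
      rcases w with _ | ⟨b, w⟩ <;> simp [X]
    · rw [tail_geom_of_ne h]
      simp [X, h]

/-- The unit `1 + X s` of the ring of series. -/
@[simps] noncomputable def oneAddX (s : S) : (NCSeries S)ˣ :=
  ⟨1 + X s, geom s, one_add_X_mul_geom s, geom_mul_one_add_X s⟩

/-! ### The Magnus expansion -/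

/-- The Magnus expansion `s ↦ 1 + X s` of the free group. -/
noncomputable def magnus : FreeGroup S →* (NCSeries S)ˣ := FreeGroup.lift oneAddX

@[simp] theorem magnus_of (s : S) : (magnus (FreeGroup.of s) : NCSeries S) = 1 + X s := by
  simp [magnus]

theorem units_inv_nil {u : (NCSeries S)ˣ} (h : (u : NCSeries S) [] = 1) :
    ((u⁻¹ : (NCSeries S)ˣ) : NCSeries S) [] = 1 := by
  have h' := congrArg (fun f : NCSeries S => f []) u.mul_inv
  simpa [h] using h'

@[simp] theorem magnus_nil (k : FreeGroup S) : (magnus k : NCSeries S) [] = 1 := by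
  induction k using FreeGroup.induction_on with
  | C1 => simp
  | of s => simp
  | inv_of s h => rw [map_inv]; exact units_inv_nil h
  | mul a b ha hb => rw [map_mul, Units.val_mul, mul_nil, ha, hb, mul_one]

/-! ### Faithfulness of the Magnus expansion -/

/-- Multiplication by a power of `1 + X s` does not change the coefficient at a word that does not
begin with `s`; at a word in which the initial `s` is not repeated only the linear term of that
power contributes. -/
theorem magnus_zpow_mul_apply (s : S) (e : ℤ) (g : NCSeries S) :
    (∀ v : List S, (∀ a ∈ v.head?, s ≠ a) →
      ((magnus (FreeGroup.of s ^ e) : NCSeries S) * g) v = g v) ∧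
    ∀ v : List S, (∀ a ∈ v.head?, s ≠ a) →
      ((magnus (FreeGroup.of s ^ e) : NCSeries S) * g) (s :: v) = g (s :: v) + e * g v := by
  have step (f : NCSeries S) :
      (∀ v : List S, (∀ a ∈ v.head?, s ≠ a) → ((1 + X s) * f) v = f v) ∧
      ∀ v : List S, ((1 + X s) * f) (s :: v) = f (s :: v) + f v := by
    refine ⟨fun v hv => ?_, fun v => ?_⟩
    · rw [add_mul, one_mul, add_apply]
      rcases v with _ | ⟨a, v⟩
      · simp
      · rw [X_mul_cons_of_ne (Ne.symm (by simpa using hv)), add_zero]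
    · rw [add_mul, one_mul, add_apply, X_mul_cons_self]
  have succ (n : ℤ) : (magnus (FreeGroup.of s ^ (n + 1)) : NCSeries S) * g
      = (1 + X s) * ((magnus (FreeGroup.of s ^ n) : NCSeries S) * g) := by
    rw [add_comm, zpow_add, zpow_one, map_mul, Units.val_mul, magnus_of, mul_assoc]
  induction e using Int.induction_on with
  | zero => simp
  | succ n ih =>
    rw [succ]
    refine ⟨fun v hv => ?_, fun v hv => ?_⟩
    · rw [(step _).1 v hv, ih.1 v hv]
    · rw [(step _).2 v, ih.1 v hv, ih.2 v hv]
      ring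
  | pred n ih =>
    have h := succ (-n - 1)
    rw [sub_add_cancel] at h
    rw [h] at ih
    have h1 (v : List S) (hv : ∀ a ∈ v.head?, s ≠ a) := ((step _).1 v hv).symm.trans (ih.1 v hv)
    refine ⟨h1, fun v hv => ?_⟩
    have h2 := ih.2 v hv
    rw [(step _).2 v, h1 v hv] at h2
    linear_combination h2

/-- The product of the powers `s ^ e` over a list of pairs `(s, e)`. -/
def syllableProd (L : List (S × ℤ)) : FreeGroup S :=
  (L.map fun p => FreeGroup.of p.1 ^ p.2).prod

/-- A list of syllables is reduced when no exponent vanishes and adjacent letters differ. -/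
def IsReducedSyllables (L : List (S × ℤ)) : Prop :=
  (∀ p ∈ L, p.2 ≠ 0) ∧ (L.map Prod.fst).IsChain (· ≠ ·)

theorem exists_syllables_zpow_mul (s : S) (e : ℤ) {L : List (S × ℤ)} (hL : IsReducedSyllables L) :
    ∃ L', IsReducedSyllables L' ∧ syllableProd L' = FreeGroup.of s ^ e * syllableProd L := by
  rcases eq_or_ne e 0 with rfl | he
  · exact ⟨L, hL, by simp⟩
  rcases L with _ | ⟨⟨a, m⟩, L⟩
  · exact ⟨[(s, e)], ⟨by simpa using he, by simp⟩, by simp [syllableProd]⟩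
  have hred : IsReducedSyllables L := by
    refine ⟨fun p hp => hL.1 p (List.mem_cons_of_mem _ hp), ?_⟩
    have h := hL.2
    rw [List.map_cons, List.isChain_cons] at h
    exact h.2
  by_cases h : a = s
  · subst h
    by_cases hm : e + m = 0
    · refine ⟨L, hred, ?_⟩
      simp [syllableProd, ← mul_assoc, ← zpow_add, hm]
    · refine ⟨(a, e + m) :: L, ⟨?_, by simpa using hL.2⟩, ?_⟩
      · rintro p (_ | ⟨_, hp⟩)
        · exact hm
        · exact hred.1 p hp
      · simp [syllableProd, ← mul_assoc, ← zpow_add]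
  · refine ⟨(s, e) :: (a, m) :: L, ⟨?_, ?_⟩, by simp [syllableProd]⟩
    · rintro p (_ | ⟨_, hp⟩)
      · exact he
      · exact hL.1 p hp
    · rw [List.map_cons, List.map_cons, List.isChain_cons_cons]
      exact ⟨Ne.symm h, hL.2⟩

theorem exists_syllables (k : FreeGroup S) :
    ∃ L, IsReducedSyllables L ∧ syllableProd L = k := by
  suffices h : ∀ L, IsReducedSyllables L →
      ∃ L', IsReducedSyllables L' ∧ syllableProd L' = k * syllableProd L by
    simpa [syllableProd] using h [] ⟨by simp, by simp⟩
  induction k using FreeGroup.induction_on with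
  | C1 => exact fun L hL => ⟨L, hL, (one_mul _).symm⟩
  | of s => exact fun L hL => by simpa using exists_syllables_zpow_mul s 1 hL
  | inv_of s _ => exact fun L hL => by simpa using exists_syllables_zpow_mul s (-1) hL
  | mul a b ha hb =>
    intro L hL
    obtain ⟨L₁, h₁, e₁⟩ := hb L hL
    obtain ⟨L₂, h₂, e₂⟩ := ha L₁ h₁
    exact ⟨L₂, h₂, by rw [e₂, e₁, mul_assoc]⟩

/-- The coefficient of the Magnus expansion at the word of letters of a reduced syllable
decomposition is the product of the exponents, and the coefficient at every longer word without
repetition of adjacent letters vanishes. -/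
theorem magnus_syllableProd {L : List (S × ℤ)} (hL : IsReducedSyllables L) :
    (magnus (syllableProd L) : NCSeries S) (L.map Prod.fst) = (L.map Prod.snd).prod ∧
    ∀ v : List S, v.IsChain (· ≠ ·) → L.length < v.length →
      (magnus (syllableProd L) : NCSeries S) v = 0 := by
  induction L with
  | nil =>
    refine ⟨by simp, fun v _ hv => ?_⟩
    rcases v with _ | ⟨a, v⟩
    · simp at hv
    · simp [syllableProd]
  | cons p L ih =>
    obtain ⟨s, e⟩ := p
    have hc := hL.2
    rw [List.map_cons, List.isChain_cons] at hc
    obtain ⟨ih1, ih2⟩ := ih ⟨fun p hp => hL.1 p (List.mem_cons_of_mem _ hp), hc.2⟩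
    have hm : (magnus (syllableProd ((s, e) :: L)) : NCSeries S) =
        (magnus (FreeGroup.of s ^ e) : NCSeries S) * (magnus (syllableProd L) : NCSeries S) := by
      rw [← Units.val_mul, ← map_mul]
      simp [syllableProd]
    obtain ⟨h1, h2⟩ := magnus_zpow_mul_apply s e (magnus (syllableProd L) : NCSeries S)
    rw [hm]
    refine ⟨?_, fun v hv hlen => ?_⟩
    · have hz := ih2 (s :: L.map Prod.fst) hL.2 (by simp)
      rw [List.map_cons, h2 _ hc.1, ih1, hz]
      simp
    · rw [List.length_cons] at hlen
      by_cases hs : ∀ a ∈ v.head?, s ≠ a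
      · rw [h1 v hs, ih2 v hv (by lia)]
      · rcases v with _ | ⟨a, v⟩
        · simp at hs
        · obtain rfl : s = a := by simpa using hs
          have hv' := List.isChain_cons.1 hv
          rw [List.length_cons] at hlen
          rw [h2 v hv'.1, ih2 _ hv (by simp; lia), ih2 v hv'.2 (by lia)]
          simp

theorem exists_magnus_ne_zero {k : FreeGroup S} (hk : k ≠ 1) :
    ∃ w ≠ [], (magnus k : NCSeries S) w ≠ 0 := by
  obtain ⟨L, hL, rfl⟩ := exists_syllables k
  refine ⟨L.map Prod.fst, fun h => hk ?_, ?_⟩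
  · rw [List.map_eq_nil_iff.1 h]
    rfl
  · rw [(magnus_syllableProd hL).1]
    refine List.prod_ne_zero fun h => ?_
    obtain ⟨p, hp, h0⟩ := List.mem_map.1 h
    exact hL.1 p hp h0

/-! ### Letters occurring in a Magnus expansion -/

/-- Only letters from `T` occur in the monomials of `f`. -/
def LettersIn (T : Set S) (f : NCSeries S) : Prop := ∀ w : List S, f w ≠ 0 → ∀ a ∈ w, a ∈ T

theorem LettersIn.mono {T T' : Set S} (h : T ⊆ T') {f : NCSeries S} (hf : LettersIn T f) :
    LettersIn T' f := fun w hw a ha => h (hf w hw a ha)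

theorem LettersIn.mul {T : Set S} {f g : NCSeries S} (hf : LettersIn T f) (hg : LettersIn T g) :
    LettersIn T (f * g) := by
  intro w
  induction w generalizing f with
  | nil => simp
  | cons b w ih =>
    intro hw
    rw [mul_cons] at hw
    by_cases h1 : f [] * g (b :: w) = 0
    · rw [h1, zero_add] at hw
      have ht : tail b f ≠ 0 := fun h0 => hw (by rw [h0, zero_mul, zero_apply])
      obtain ⟨v, hv⟩ : ∃ v, tail b f v ≠ 0 := by
        by_contra! hc
        exact ht (ext hc)
      have hb := hf (b :: v) hv b (by simp)
      have hr := ih (f := tail b f) (fun v hv a ha => hf (b :: v) hv a (by simp [ha])) hw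
      rintro a (_ | ⟨_, ha⟩)
      · exact hb
      · exact hr a ha
    · exact hg _ (right_ne_zero_of_mul h1)

theorem exists_lettersIn_magnus (k : FreeGroup S) :
    ∃ T : Set S, T.Finite ∧ LettersIn T (magnus k : NCSeries S) := by
  induction k using FreeGroup.induction_on with
  | C1 =>
    refine ⟨∅, Set.finite_empty, fun w hw => ?_⟩
    rcases w with _ | ⟨a, w⟩
    · simp
    · simp at hw
  | of s =>
    refine ⟨{s}, Set.finite_singleton s, fun w hw => ?_⟩
    rcases w with _ | ⟨a, w⟩
    · simp
    · rw [magnus_of, add_apply, one_cons, zero_add, X] at hw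
      have h : a :: w = [s] := by
        by_contra hc
        exact hw (if_neg hc)
      simp [h]
  | inv_of s _ =>
    refine ⟨{s}, Set.finite_singleton s, fun w hw => ?_⟩
    by_contra hc
    refine hw ?_
    rw [map_inv, magnus, FreeGroup.lift_apply_of]
    exact if_neg hc
  | mul a b ha hb =>
    obtain ⟨T, hT, hTa⟩ := ha
    obtain ⟨U, hU, hUb⟩ := hb
    refine ⟨T ∪ U, hT.union hU, ?_⟩
    rw [map_mul, Units.val_mul]
    exact (hTa.mono Set.subset_union_left).mul (hUb.mono Set.subset_union_right)

theorem finite_support_magnus (k : FreeGroup S) (n : ℕ) :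
    {w : List S | w.length ≤ n ∧ (magnus k : NCSeries S) w ≠ 0}.Finite := by
  obtain ⟨T, hT, h⟩ := exists_lettersIn_magnus k
  have := hT.to_subtype
  refine ((List.finite_length_le T n).image (List.map Subtype.val)).subset ?_
  rintro w ⟨hl, hw⟩
  refine ⟨w.attach.map fun a => ⟨a.1, h w hw a.1 a.2⟩, by simpa using hl, ?_⟩
  simp

/-! ### Leading forms under endomorphisms -/

/-- Substitution of the series `Y s` for the variables in a noncommutative polynomial. -/
noncomputable def subst (Y : S → NCSeries S) :
    MonoidAlgebra ℤ (FreeMonoid S) →ₐ[ℤ] NCSeries S :=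
  MonoidAlgebra.lift ℤ (NCSeries S) (FreeMonoid S) (FreeMonoid.lift Y)

/-- The value of a homomorphism from the free group to the units of the ring of series at `k` is
approximated to any order by a polynomial in its values at the generators, and the polynomial
does not depend on the homomorphism. -/
theorem exists_subst_approx (N : ℕ) (k : FreeGroup S) :
    ∃ p : MonoidAlgebra ℤ (FreeMonoid S), ∀ θ : FreeGroup S →* (NCSeries S)ˣ,
      (∀ s, OrderGE 1 ((θ (FreeGroup.of s) : NCSeries S) - 1)) →
      OrderGE N ((θ k : NCSeries S) - subst (fun s => (θ (FreeGroup.of s) : NCSeries S) - 1) p) := by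
  induction k using FreeGroup.induction_on with
  | C1 => exact ⟨1, fun θ _ w _ => by simp⟩
  | of s =>
    refine ⟨1 + MonoidAlgebra.of ℤ _ (FreeMonoid.of s), fun θ _ w _ => ?_⟩
    simp [subst]
  | inv_of s _ =>
    -- the truncated geometric series of `(1 + y)⁻¹`
    refine ⟨∑ i ∈ Finset.range N, (-MonoidAlgebra.of ℤ _ (FreeMonoid.of s)) ^ i, fun θ hθ => ?_⟩
    set u := θ (FreeGroup.of s) with hu
    have hsum : (u : NCSeries S) * ∑ i ∈ Finset.range N, (-((u : NCSeries S) - 1)) ^ i =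
        1 - (-((u : NCSeries S) - 1)) ^ N := by
      rw [← mul_neg_geom_sum]
      congr 1
      abel
    have he : subst (fun s => (θ (FreeGroup.of s) : NCSeries S) - 1)
        (∑ i ∈ Finset.range N, (-MonoidAlgebra.of ℤ _ (FreeMonoid.of s)) ^ i) =
        ∑ i ∈ Finset.range N, (-((u : NCSeries S) - 1)) ^ i := by
      simp only [map_sum, map_pow, map_neg, subst, MonoidAlgebra.lift_of, FreeMonoid.lift_eval_of,
        hu]
    have hd : ((θ (FreeGroup.of s)⁻¹ : (NCSeries S)ˣ) : NCSeries S) -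
        ∑ i ∈ Finset.range N, (-((u : NCSeries S) - 1)) ^ i =
        ((u⁻¹ : (NCSeries S)ˣ) : NCSeries S) * (-((u : NCSeries S) - 1)) ^ N := by
      rw [map_inv, ← hu, ← sub_eq_zero, ← Units.mul_right_eq_zero u, mul_sub, mul_sub, hsum,
        Units.mul_inv, Units.mul_inv_cancel_left]
      abel
    rw [he, hd]
    exact ((hθ s).neg.pow N).mul_left _
  | mul a b ha hb =>
    obtain ⟨p, hp⟩ := ha
    obtain ⟨q, hq⟩ := hb
    refine ⟨p * q, fun θ hθ => ?_⟩
    have e (a a' b b' : NCSeries S) : a * b - a' * b' = (a - a') * b + a' * (b - b') := by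
      rw [sub_mul, mul_sub]
      abel
    rw [map_mul, map_mul, Units.val_mul, e]
    exact ((hp θ hθ).mul_right _).add ((hq θ hθ).mul_left _)

/-- If the linear part of each `Y s` is the single variable `X (π s)`, then the leading form of the
product of the `Y s` along a word `u` is the word `u.map π`. -/
theorem prod_map_apply [DecidableEq S] {Y : S → NCSeries S} {π : Equiv.Perm S}
    (h1 : ∀ s, OrderGE 1 (Y s)) (hX : ∀ s a, Y s [a] = X (π s) [a]) (u : List S) :
    OrderGE u.length (u.map Y).prod ∧
    ∀ w : List S, w.length = u.length → (u.map Y).prod (w.map π) = if w = u then 1 else 0 := by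
  induction u with
  | nil =>
    refine ⟨fun w hw => by simp at hw, fun w hw => ?_⟩
    rw [List.length_eq_zero_iff.1 hw]
    simp
  | cons s u ih =>
    rw [List.map_cons, List.prod_cons]
    refine ⟨?_, fun w hw => ?_⟩
    · rw [List.length_cons, add_comm]
      exact (h1 s).mul ih.1
    · rcases w with _ | ⟨a, w⟩
      · simp at hw
      · have hw' : w.length = u.length := by simpa using hw
        rw [List.map_cons, mul_cons, h1 s [] (by simp), zero_mul, zero_add,
          ih.1.mul_apply_left _ (by simp [hw']), ih.2 w hw', tail_apply, hX]
        by_cases ha : a = s <;> simp [X, ha]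

theorem prod_map_X_apply [DecidableEq S] (u w : List S) :
    (u.map (X : S → NCSeries S)).prod w = if w = u then 1 else 0 := by
  induction u generalizing w with
  | nil => cases w <;> simp
  | cons s u ih =>
    rw [List.map_cons, List.prod_cons]
    rcases w with _ | ⟨a, w⟩
    · simp
    · by_cases ha : a = s
      · subst ha
        rw [X_mul_cons_self, ih]
        simp
      · rw [X_mul_cons_of_ne ha]
        simp [ha]

theorem subst_apply (Y : S → NCSeries S) (p : MonoidAlgebra ℤ (FreeMonoid S)) (w : List S) :
    subst Y p w = p.coeff.sum fun u c => c * (u.toList.map Y).prod w := by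
  rw [subst, MonoidAlgebra.lift_apply]
  let ev : NCSeries S →+ ℤ := ⟨⟨fun f => f w, rfl⟩, fun _ _ => rfl⟩
  refine (map_finsuppSum ev p.coeff fun u c => c • FreeMonoid.lift Y u).trans ?_
  refine Finsupp.sum_congr fun u _ => ?_
  rw [FreeMonoid.lift_apply]
  rfl

theorem subst_X_apply (p : MonoidAlgebra ℤ (FreeMonoid S)) (w : List S) :
    subst X p w = p.coeff (FreeMonoid.ofList w) := by
  classical
  rw [subst_apply, Finsupp.sum_eq_single (FreeMonoid.ofList w)]
  · rw [prod_map_X_apply]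
    simp
  · intro u _ hu
    rw [prod_map_X_apply, if_neg, mul_zero]
    rintro rfl
    exact hu rfl
  · simp

/-- If a homomorphism `θ` agrees with the Magnus expansion composed with a permutation `π` of the
variables up to terms of degree two on generators, then it agrees with it up to and including the
degree of the leading form of `k`, for each `k`. -/
theorem leading_form_apply {θ : FreeGroup S →* (NCSeries S)ˣ} {π : Equiv.Perm S}
    (h1 : ∀ s, OrderGE 1 ((θ (FreeGroup.of s) : NCSeries S) - 1))
    (hX : ∀ s a, ((θ (FreeGroup.of s) : NCSeries S) - 1) [a] = X (π s) [a])
    {k : FreeGroup S} {n : ℕ} (hk : OrderGE n ((magnus k : NCSeries S) - 1))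
    {w : List S} (hw : w.length ≤ n) :
    (θ k : NCSeries S) (w.map π) = (magnus k : NCSeries S) w := by
  classical
  obtain ⟨p, hp⟩ := exists_subst_approx (n + 1) k
  have hθ := hp θ h1 (w.map π) (by simp; lia)
  have hcoeff (v : List S) (hv : v.length ≤ n) :
      (magnus k : NCSeries S) v = p.coeff (FreeMonoid.ofList v) := by
    have hm := hp magnus (fun s => by simpa using X_orderGE s) v (by lia)
    have hY : (fun s : S => (magnus (FreeGroup.of s) : NCSeries S) - 1) = X := by
      funext s
      simp
    rw [hY, sub_apply, subst_X_apply] at hm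
    linarith
  have hzero (v : List S) (hv0 : v ≠ []) (hv : v.length < n) :
      p.coeff (FreeMonoid.ofList v) = 0 := by
    rw [← hcoeff v hv.le]
    have h := hk v hv
    rcases v with _ | ⟨a, v⟩
    · exact absurd rfl hv0
    · simpa using h
  rw [sub_apply, sub_eq_zero, subst_apply, Finsupp.sum_eq_single (FreeMonoid.ofList w)] at hθ
  · rw [hθ, hcoeff w hw, FreeMonoid.toList_ofList, (prod_map_apply h1 hX w).2 w rfl]
    simp
  · intro u hu0 hu
    have hu' : w ≠ u.toList := fun h => hu (by rw [h, FreeMonoid.ofList_toList])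
    obtain ⟨hge, heq⟩ := prod_map_apply h1 hX u.toList
    rcases lt_trichotomy w.length u.toList.length with hl | hl | hl
    · rw [hge (w.map π) (by simpa using hl), mul_zero]
    · rw [heq w hl, if_neg hu', mul_zero]
    · by_cases hnil : u.toList = []
      · rcases w with _ | ⟨a, w⟩
        · simp at hl
        · rw [hnil]
          simp
      · exact absurd (hzero u.toList hnil (by lia)) hu0
  · simp

/-! ### The positive cone of the free group -/

/-- Up to the degree of its leading form the Magnus expansion is additive. -/
theorem magnus_mul_apply {k l : FreeGroup S} {n : ℕ} (hk : OrderGE n ((magnus k : NCSeries S) - 1))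
    {u : List S} (hu : u ≠ []) (hn : u.length ≤ n) :
    (magnus (k * l) : NCSeries S) u = (magnus k : NCSeries S) u + (magnus l : NCSeries S) u := by
  have e : (magnus (k * l) : NCSeries S) =
      ((magnus k : NCSeries S) - 1) * (magnus l : NCSeries S) + (magnus l : NCSeries S) := by
    rw [sub_mul, one_mul, sub_add_cancel, map_mul, Units.val_mul]
  rw [e, add_apply, hk.mul_apply_right _ hn, magnus_nil, mul_one, sub_apply]
  rcases u with _ | ⟨a, u⟩
  · exact absurd rfl hu
  · simp

theorem magnus_inv_apply {k : FreeGroup S} {n : ℕ} (hk : OrderGE n ((magnus k : NCSeries S) - 1))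
    {u : List S} (hu : u ≠ []) (hn : u.length ≤ n) :
    (magnus k⁻¹ : NCSeries S) u = -(magnus k : NCSeries S) u := by
  have h := magnus_mul_apply (l := k⁻¹) hk hu hn
  rw [mul_inv_cancel, map_one, Units.val_one] at h
  rcases u with _ | ⟨a, u⟩
  · exact absurd rfl hu
  · rw [one_cons] at h
    linarith

/-- The key by which words are compared: by length, and words of equal length
lexicographically. -/
def wordKey (w : List S) : ℕ ×ₗ List S := toLex (w.length, w)

theorem wordKey_injective : Function.Injective (wordKey : List S → ℕ ×ₗ List S) := by
  intro v w h
  exact congrArg (fun x => (ofLex x).2) h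

variable [LinearOrder S]

theorem wordKey_lt_iff {v w : List S} :
    wordKey v < wordKey w ↔ v.length < w.length ∨ v.length = w.length ∧ v < w :=
  Prod.Lex.toLex_lt_toLex

theorem length_le_of_wordKey_le {v w : List S} (h : wordKey v ≤ wordKey w) :
    v.length ≤ w.length := by
  rcases Prod.Lex.toLex_le_toLex.1 h with h | h
  · exact h.le
  · exact h.1.le

theorem wordKey_map_lt {π : S → S} (hπ : StrictMono π) {v w : List S}
    (h : wordKey v < wordKey w) : wordKey (v.map π) < wordKey (w.map π) := by
  rw [wordKey_lt_iff] at h ⊢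
  simp only [List.length_map]
  exact h.imp_right fun h => ⟨h.1, List.map_lt (fun _ _ hxy => hπ hxy) h.2⟩

/-- No nonempty word that precedes `w` occurs in the Magnus expansion of `k`. -/
def VanishesBelow (k : FreeGroup S) (w : List S) : Prop :=
  ∀ u ≠ [], wordKey u < wordKey w → (magnus k : NCSeries S) u = 0

/-- An element of the free group is positive when the first nonempty word, in the order of
`wordKey`, that occurs in its Magnus expansion has a positive coefficient. -/
def IsPos (k : FreeGroup S) : Prop :=
  ∃ w ≠ [], 0 < (magnus k : NCSeries S) w ∧ VanishesBelow k w

theorem VanishesBelow.mono {k : FreeGroup S} {v w : List S} (h : wordKey v ≤ wordKey w)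
    (hk : VanishesBelow k w) : VanishesBelow k v := fun u hu huv => hk u hu (huv.trans_le h)

theorem VanishesBelow.orderGE {k : FreeGroup S} {w : List S} (hk : VanishesBelow k w) :
    OrderGE w.length ((magnus k : NCSeries S) - 1) := by
  intro u hu
  rcases u with _ | ⟨a, u⟩
  · simp
  · rw [sub_apply, hk _ (by simp) (wordKey_lt_iff.2 (Or.inl hu)), one_cons, sub_zero]

theorem VanishesBelow.mul {k l : FreeGroup S} {w : List S} (hk : VanishesBelow k w)
    (hl : VanishesBelow l w) : VanishesBelow (k * l) w := fun u hu huw => by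
  rw [magnus_mul_apply hk.orderGE hu (length_le_of_wordKey_le huw.le), hk u hu huw, hl u hu huw,
    add_zero]

theorem VanishesBelow.inv {k : FreeGroup S} {w : List S} (hk : VanishesBelow k w) :
    VanishesBelow k⁻¹ w := fun u hu huw => by
  rw [magnus_inv_apply hk.orderGE hu (length_le_of_wordKey_le huw.le), hk u hu huw, neg_zero]

theorem not_isPos_one : ¬ IsPos (1 : FreeGroup S) := by
  rintro ⟨w, hw, hpos, -⟩
  rcases w with _ | ⟨a, w⟩
  · exact hw rfl
  · simp at hpos

theorem IsPos.mul {k l : FreeGroup S} (hk : IsPos k) (hl : IsPos l) : IsPos (k * l) := by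
  obtain ⟨v, hv, hvpos, hkv⟩ := hk
  obtain ⟨w, hw, hwpos, hlw⟩ := hl
  rcases lt_trichotomy (wordKey v) (wordKey w) with h | h | h
  · refine ⟨v, hv, ?_, hkv.mul (hlw.mono h.le)⟩
    rwa [magnus_mul_apply hkv.orderGE hv le_rfl, hlw v hv h, add_zero]
  · obtain rfl := wordKey_injective h
    refine ⟨v, hv, ?_, hkv.mul hlw⟩
    rw [magnus_mul_apply hkv.orderGE hv le_rfl]
    exact add_pos hvpos hwpos
  · have hkw := hkv.mono h.le
    refine ⟨w, hw, ?_, hkw.mul hlw⟩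
    rwa [magnus_mul_apply hkw.orderGE hw le_rfl, hkv w hw h, zero_add]

theorem isPos_or_isPos_inv {k : FreeGroup S} (hk : k ≠ 1) : IsPos k ∨ IsPos k⁻¹ := by
  obtain ⟨v, hv, hne⟩ := exists_magnus_ne_zero hk
  -- the expansion has finitely many terms in each degree, so there is a first one
  obtain ⟨w, ⟨⟨-, hwne⟩, hw⟩, hmin⟩ := Set.exists_min_image
    ({w : List S | w.length ≤ v.length ∧ (magnus k : NCSeries S) w ≠ 0} ∩ {w | w ≠ []}) wordKey
    ((finite_support_magnus k v.length).inter_of_left _) ⟨v, ⟨le_rfl, hne⟩, hv⟩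
  have hwv : wordKey w ≤ wordKey v := hmin v ⟨⟨le_rfl, hne⟩, hv⟩
  have hbelow : VanishesBelow k w := by
    intro u hu huw
    by_contra h
    exact (hmin u ⟨⟨length_le_of_wordKey_le (huw.trans_le hwv).le, h⟩, hu⟩).not_gt huw
  rcases lt_or_gt_of_ne hwne with h | h
  · refine Or.inr ⟨w, hw, ?_, hbelow.inv⟩
    rw [magnus_inv_apply hbelow.orderGE hw le_rfl]
    linarith
  · exact Or.inl ⟨w, hw, h, hbelow⟩

/-- The order is invariant under every endomorphism that maps each generator `s` to a conjugate of
`π s`, where `π` is an order-preserving permutation of the generators: such an endomorphism acts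
on leading forms by applying `π` to the letters. -/
theorem IsPos.map {α : FreeGroup S →* FreeGroup S} {π : Equiv.Perm S} (hπ : StrictMono π)
    {c : S → FreeGroup S}
    (hα : ∀ s, α (FreeGroup.of s) = c s * FreeGroup.of (π s) * (c s)⁻¹)
    {k : FreeGroup S} (hk : IsPos k) : IsPos (α k) := by
  have hY (s : S) : (((magnus.comp α) (FreeGroup.of s) : (NCSeries S)ˣ) : NCSeries S) - 1 =
      (magnus (c s) : NCSeries S) * (X (π s) * (((magnus (c s))⁻¹ : (NCSeries S)ˣ) : NCSeries S)) := by
    rw [MonoidHom.comp_apply, hα, map_mul, map_mul, map_inv, Units.val_mul, Units.val_mul,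
      magnus_of, mul_add, mul_one, add_mul, Units.mul_inv, mul_assoc, add_sub_cancel_left]
  have hX1 (s : S) : OrderGE 1 (X (π s) * (((magnus (c s))⁻¹ : (NCSeries S)ˣ) : NCSeries S)) :=
    (X_orderGE _).mul_right _
  obtain ⟨w, hw, hpos, hbelow⟩ := hk
  have key {u : List S} (hu : u.length ≤ w.length) :
      (magnus (α k) : NCSeries S) (u.map π) = (magnus k : NCSeries S) u := by
    refine leading_form_apply (θ := magnus.comp α) (fun s => ?_) (fun s a => ?_) hbelow.orderGE hu
    · rw [hY]
      exact (hX1 s).mul_left _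
    · rw [hY, (hX1 s).mul_apply_left _ (by simp), (X_orderGE _).mul_apply_right _ (by simp),
        magnus_nil, units_inv_nil (magnus_nil _), one_mul, mul_one]
  refine ⟨w.map π, by simpa using hw, by rwa [key le_rfl], fun u hu huw => ?_⟩
  obtain ⟨z, rfl⟩ : ∃ z : List S, u = z.map π := ⟨u.map π.symm, by simp [List.map_map]⟩
  have hzw : wordKey z < wordKey w := by
    by_contra! h
    rcases h.lt_or_eq with h | h
    · exact (wordKey_map_lt hπ h).not_gt huw
    · rw [wordKey_injective h] at huw
      exact huw.false
  rw [key (length_le_of_wordKey_le hzw.le)]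
  exact hbelow z (by simpa using hu) hzw

end NCSeries

/-! ### Invariant linear orders for actions of abelian groups -/

/-- An abelian group acts on a set by order automorphisms of some linear order, provided that the
stabilizer of each point is the kernel of a homomorphism to a linearly ordered group: then each
orbit embeds equivariantly in that ordered group. -/
theorem exists_linearOrder_smul_strictMono {A S L : Type*} [CommGroup A] [MulAction A S]
    [AddCommGroup L] [LinearOrder L] [IsOrderedAddMonoid L]
    (h : ∀ s : S, ∃ θ : A →* Multiplicative L, ∀ a : A, a • s = s ↔ θ a = 1) :
    ∃ _ : LinearOrder S, ∀ a : A, StrictMono fun s : S => a • s := by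
  classical
  choose θ hθ using h
  let O := MulAction.orbitRel.Quotient A S
  let orb : S → O := Quotient.mk _
  let rep : O → S := Quotient.out
  have hrep (s : S) : ∃ a : A, a • rep (orb s) = s := by
    have h : MulAction.orbitRel A S s (rep (orb s)) :=
      (MulAction.orbitRel A S).symm (Quotient.mk_out (s := MulAction.orbitRel A S) s)
    exact MulAction.mem_orbit_iff.1 (MulAction.orbitRel_apply.1 h)
  choose g hg using hrep
  have horb (a : A) (s : S) : orb (a • s) = orb s :=
    Quotient.sound (MulAction.orbitRel_apply.2 (MulAction.mem_orbit s a))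
  let c : S → Multiplicative L := fun s => θ (rep (orb s)) (g s)
  have hc (a : A) (s : S) : c (a • s) = θ (rep (orb s)) a * c s := by
    have h1 := hg (a • s)
    simp only [c]
    rw [horb] at h1 ⊢
    have h2 : ((a * g s)⁻¹ * g (a • s)) • rep (orb s) = rep (orb s) := by
      rw [mul_smul, h1, inv_smul_eq_iff, mul_smul, hg]
    rw [hθ, map_mul, map_inv, inv_mul_eq_one, map_mul] at h2
    exact h2.symm
  -- orbits are ordered arbitrarily among themselves
  let _ : LinearOrder O := linearOrderOfSTO WellOrderingRel
  let key : S → O ×ₗ L := fun s => toLex (orb s, Multiplicative.toAdd (c s))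
  have hkey : Function.Injective key := by
    intro s t hst
    have ho : orb s = orb t := congrArg (fun x => (ofLex x).1) hst
    have hcc : c s = c t := congrArg (fun x => (ofLex x).2) hst
    simp only [c] at hcc
    rw [ho, ← inv_mul_eq_one, ← map_inv, ← map_mul, ← hθ, mul_smul, inv_smul_eq_iff, hg t] at hcc
    calc s = g s • rep (orb s) := (hg s).symm
      _ = g s • rep (orb t) := by rw [ho]
      _ = t := hcc.symm
  refine ⟨LinearOrder.lift' key hkey, fun a s t hst => ?_⟩
  change key (a • s) < key (a • t)
  have hst' : key s < key t := hst
  rw [Prod.Lex.toLex_lt_toLex] at hst' ⊢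
  simp only [horb, hc, toAdd_mul] at hst' ⊢
  refine hst'.imp_right fun h => ⟨h.1, ?_⟩
  rw [h.1]
  exact add_lt_add_right h.2 _

/-! ### The order on the generators of the kernel -/

section SkewProduct

variable {J : Type*}

/-- The action of `ℤ` on `J × ℤ` by translations of the second coordinate. -/
def shiftHom (J : Type*) : Multiplicative ℤ →* Equiv.Perm (J × ℤ) where
  toFun c := (Equiv.refl J).prodCongr (Equiv.addRight c.toAdd)
  map_one' := by ext <;> simp
  map_mul' a b := by
    ext s
    · simp
    · simp only [toAdd_mul, Equiv.prodCongr_apply, Prod.map_snd, Equiv.coe_addRight,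
        Equiv.Perm.coe_mul, Function.comp_apply]
      ring

@[simp] theorem shiftHom_apply (c : Multiplicative ℤ) (s : J × ℤ) :
    shiftHom J c s = (s.1, s.2 + c.toAdd) := rfl

/-- The skew product of `σ` with the cocycle `m`: the permutation `(j, n) ↦ (σ j, n + m j)`. -/
@[simps] def skewPerm (σ : Equiv.Perm J) (m : J → ℤ) : Equiv.Perm (J × ℤ) where
  toFun s := (σ s.1, s.2 + m s.1)
  invFun s := (σ.symm s.1, s.2 - m (σ.symm s.1))
  left_inv s := by simp
  right_inv s := by simp

theorem shiftHom_commute_skewPerm (σ : Equiv.Perm J) (m : J → ℤ) (c : Multiplicative ℤ) :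
    Commute (shiftHom J c) (skewPerm σ m) := by
  ext s
  · simp
  · simp
    ring

theorem skewPerm_pow_apply (σ : Equiv.Perm J) (m : J → ℤ) (d : ℕ) (s : J × ℤ) :
    (skewPerm σ m ^ d) s = ((σ ^ d) s.1, s.2 + ∑ k ∈ Finset.range d, m ((σ ^ k) s.1)) := by
  induction d with
  | zero => simp
  | succ d ih =>
    rw [pow_succ', Equiv.Perm.mul_apply, ih, skewPerm_apply, Finset.sum_range_succ, pow_succ',
      Equiv.Perm.mul_apply, add_assoc]

theorem skewPerm_zpow_apply_fst (σ : Equiv.Perm J) (m : J → ℤ) (b : ℤ) (s : J × ℤ) :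
    ((skewPerm σ m ^ b) s).1 = (σ ^ b) s.1 := by
  obtain ⟨d, rfl | rfl⟩ := b.eq_nat_or_neg
  · simp [skewPerm_pow_apply]
  · rw [zpow_neg, zpow_neg, zpow_natCast, zpow_natCast, Equiv.Perm.eq_inv_iff_eq]
    have h := skewPerm_pow_apply σ m d (((skewPerm σ m ^ d)⁻¹) s)
    rw [Equiv.Perm.inv_def, Equiv.apply_symm_apply] at h
    exact (congrArg Prod.fst h).symm

/-- The action of `ℤ × ℤ` on `J × ℤ` generated by the unit translation and a skew product. -/
def skewHom (σ : Equiv.Perm J) (m : J → ℤ) :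
    Multiplicative ℤ × Multiplicative ℤ →* Equiv.Perm (J × ℤ) :=
  (shiftHom J).noncommCoprod (zpowersHom _ (skewPerm σ m))
    fun c b => (shiftHom_commute_skewPerm σ m c).zpow_right b.toAdd

theorem skewHom_apply (σ : Equiv.Perm J) (m : J → ℤ) (a : Multiplicative ℤ × Multiplicative ℤ) :
    skewHom σ m a = shiftHom J a.1 * skewPerm σ m ^ a.2.toAdd := rfl

theorem skewHom_apply_fst (σ : Equiv.Perm J) (m : J → ℤ)
    (a : Multiplicative ℤ × Multiplicative ℤ) (s : J × ℤ) :
    (skewHom σ m a s).1 = (σ ^ a.2.toAdd) s.1 := by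
  rw [skewHom_apply, Equiv.Perm.mul_apply, shiftHom_apply, skewPerm_zpow_apply_fst]

/-- The homomorphism `(a, b) ↦ (p * a + q * b, r * b)` to the lexicographically ordered `ℤ × ℤ`. -/
def lexHom (p q r : ℤ) : Multiplicative ℤ × Multiplicative ℤ →* Multiplicative (ℤ ×ₗ ℤ) where
  toFun a := Multiplicative.ofAdd (toLex (p * a.1.toAdd + q * a.2.toAdd, r * a.2.toAdd))
  map_one' := by simp
  map_mul' a b := by
    rw [← ofAdd_add, ← toLex_add, Prod.mk_add_mk]
    simp only [Prod.fst_mul, Prod.snd_mul, toAdd_mul]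
    congr 3 <;> ring

theorem lexHom_eq_one_iff {p q r : ℤ} {a : Multiplicative ℤ × Multiplicative ℤ} :
    lexHom p q r a = 1 ↔ p * a.1.toAdd + q * a.2.toAdd = 0 ∧ r * a.2.toAdd = 0 :=
  Prod.ext_iff

theorem zpow_apply_eq_self_iff (σ : Equiv.Perm J) (i : J) (b : ℤ) :
    (σ ^ b) i = i ↔ (Function.minimalPeriod σ i : ℤ) ∣ b :=
  MulAction.zpow_smul_eq_iff_minimalPeriod_dvd (a := σ) (b := i) (n := b)

theorem permOrbit_eq_image_range (σ : Equiv.Perm J) (i : J)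
    (hd : 0 < Function.minimalPeriod σ i) :
    permOrbit σ i = (fun k : ℕ => (σ ^ k) i) '' Set.Iio (Function.minimalPeriod σ i) := by
  ext y
  constructor
  · rintro ⟨n, rfl⟩
    have hd' : (0 : ℤ) < Function.minimalPeriod σ i := by exact_mod_cast hd
    obtain ⟨k, hk⟩ := Int.eq_ofNat_of_zero_le (Int.emod_nonneg n hd'.ne')
    refine ⟨k, ?_, ?_⟩
    · have := Int.emod_lt_of_pos n hd'
      rw [Set.mem_Iio]
      lia
    · have h : (σ ^ (n % (Function.minimalPeriod σ i : ℤ))) i = (σ ^ n) i :=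
        MulAction.zpow_smul_mod_minimalPeriod σ i n
      rw [hk, zpow_natCast] at h
      exact h
  · rintro ⟨k, -, rfl⟩
    exact ⟨k, by simp⟩

theorem injOn_pow_apply (σ : Equiv.Perm J) (i : J) :
    Set.InjOn (fun k : ℕ => (σ ^ k) i) (Set.Iio (Function.minimalPeriod σ i)) := by
  have h := Function.iterate_injOn_Iio_minimalPeriod (f := σ) (x := i)
  simpa only [Equiv.Perm.iterate_eq_pow] using h

/-- The coprimality condition says that the stabilizers of `ℤ × ℤ` acting on `J × ℤ` are
isolated, so that a linear order on `J × ℤ` is invariant under translations and under the skew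
product. -/
theorem exists_linearOrder_skewPerm (σ : Equiv.Perm J) (m : J → ℤ)
    (hgcd : ∀ (i : J) (hfin : (permOrbit σ i).Finite),
      Int.gcd (hfin.toFinset.card : ℤ) (∑ j ∈ hfin.toFinset, m j) = 1) :
    ∃ _ : LinearOrder (J × ℤ), (∀ c, StrictMono (shiftHom J c)) ∧ StrictMono (skewPerm σ m) := by
  let _ : MulAction (Multiplicative ℤ × Multiplicative ℤ) (J × ℤ) :=
    MulAction.compHom (J × ℤ) (skewHom σ m)
  obtain ⟨inst, h⟩ := exists_linearOrder_smul_strictMono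
    (A := Multiplicative ℤ × Multiplicative ℤ) (S := J × ℤ) (L := ℤ ×ₗ ℤ) fun s => by
    have hshift (a : Multiplicative ℤ × Multiplicative ℤ) (ha : a • s = s)
        (h2 : a.2.toAdd = 0) : a.1.toAdd = 0 := by
      have h : skewHom σ m a s = s := ha
      rw [skewHom_apply, h2, zpow_zero, mul_one] at h
      have h' := congrArg Prod.snd h
      simpa using h'
    have hdvd (a : Multiplicative ℤ × Multiplicative ℤ) (ha : a • s = s) :
        (Function.minimalPeriod σ s.1 : ℤ) ∣ a.2.toAdd := by
      rw [← zpow_apply_eq_self_iff, ← skewHom_apply_fst σ m]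
      exact congrArg Prod.fst ha
    set d := Function.minimalPeriod σ s.1 with hd
    rcases Nat.eq_zero_or_pos d with h0 | hpos
    · -- on an infinite orbit of `σ` the action is free
      refine ⟨lexHom 1 0 1, fun a => ⟨fun ha => ?_, fun ha => ?_⟩⟩
      · have h2 : a.2.toAdd = 0 := by simpa [h0] using hdvd a ha
        rw [lexHom_eq_one_iff, hshift a ha h2, h2]
        simp
      · rw [lexHom_eq_one_iff] at ha
        have ha1 : a = 1 := Prod.ext (by simpa using ha.1) (by simpa using ha.2)
        rw [ha1, one_smul]
    · -- otherwise the stabilizer is generated by `(-C, d)`, with `C` the sum of `m` over the orbit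
      set C := ∑ k ∈ Finset.range d, m ((σ ^ k) s.1) with hC
      have hcop : IsCoprime (d : ℤ) C := by
        have himg := permOrbit_eq_image_range σ s.1 hpos
        have hfin : (permOrbit σ s.1).Finite := himg ▸ (Set.finite_Iio d).image _
        classical
        have hset : hfin.toFinset = (Finset.range d).image fun k => (σ ^ k) s.1 := by
          ext y
          rw [Set.Finite.mem_toFinset, himg]
          simp [hd]
        have hinj : Set.InjOn (fun k : ℕ => (σ ^ k) s.1) (Finset.range d) := by
          rw [Finset.coe_range]
          exact injOn_pow_apply σ s.1
        have hg := hgcd s.1 hfin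
        rw [hset, Finset.card_image_of_injOn hinj, Finset.sum_image hinj, Finset.card_range] at hg
        exact Int.isCoprime_iff_gcd_eq_one.2 hg
      let g : Multiplicative ℤ × Multiplicative ℤ :=
        (Multiplicative.ofAdd (-C), Multiplicative.ofAdd (d : ℤ))
      have hg : g • s = s := by
        change skewHom σ m g s = s
        have hσ : (σ ^ d) s.1 = s.1 := by
          have h := (zpow_apply_eq_self_iff σ s.1 d).2 (by rw [hd])
          simpa using h
        rw [skewHom_apply, Equiv.Perm.mul_apply]
        simp only [g, toAdd_ofAdd, zpow_natCast, skewPerm_pow_apply, shiftHom_apply, hσ]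
        ext <;> simp [hC]
      have hgz (c : ℤ) : g ^ c • s = s := zpow_mem (K := MulAction.stabilizer _ s) hg c
      have hd0 : (d : ℤ) ≠ 0 := by exact_mod_cast hpos.ne'
      refine ⟨lexHom d C 0, fun a => ?_⟩
      rw [lexHom_eq_one_iff, zero_mul, and_iff_left rfl]
      constructor
      · intro ha
        obtain ⟨c, hc⟩ := hdvd a ha
        have h1 : (a * g ^ (-c)) • s = s := by rw [mul_smul, hgz, ha]
        have h2 := hshift _ h1 (by simp [g, hc, mul_comm])
        simp [g] at h2
        rw [hc]
        linear_combination (d : ℤ) * h2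
      · intro ha
        obtain ⟨c, hc⟩ : (d : ℤ) ∣ a.2.toAdd :=
          hcop.dvd_of_dvd_mul_left ⟨-a.1.toAdd, by linear_combination ha⟩
        have h1 : a.1.toAdd = -(C * c) := by
          apply mul_left_cancel₀ hd0
          rw [hc] at ha
          linear_combination ha
        have hac : a = g ^ c := by
          refine Prod.ext ?_ ?_
          · apply Multiplicative.toAdd.injective
            simp [g, h1, mul_comm]
          · apply Multiplicative.toAdd.injective
            simp [g, hc, mul_comm]
        rw [hac, hgz]
  refine ⟨inst, fun c => ?_, ?_⟩
  · have h1 := h (c, 1)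
    have e : (fun s : J × ℤ => (c, (1 : Multiplicative ℤ)) • s) = shiftHom J c := by
      funext s
      change skewHom σ m (c, 1) s = _
      simp [skewHom_apply]
    rwa [e] at h1
  · have h1 := h (1, Multiplicative.ofAdd 1)
    have e : (fun s : J × ℤ => ((1 : Multiplicative ℤ), Multiplicative.ofAdd (1 : ℤ)) • s) =
        skewPerm σ m := by
      funext s
      change skewHom σ m (1, Multiplicative.ofAdd 1) s = _
      simp [skewHom_apply]
    rwa [e] at h1

end SkewProduct

/-! ### The kernel of `expHom` -/

section Kernel

variable {I F : Type*} [Group F] (x : FreeGroupBasis I F) (i₀ : I)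

theorem expHom_basis_self : expHom x i₀ (x i₀) = Multiplicative.ofAdd 1 := by
  simp [expHom]

theorem expHom_basis_of_ne {i : I} (h : i ≠ i₀) : expHom x i₀ (x i) = 1 := by
  simp [expHom, h]

/-- The indices of the free generators of the kernel of `expHom x i₀`. -/
abbrev KernelIndex (i₀ : I) : Type _ := {j : I // j ≠ i₀} × ℤ

/-- The free generators of the kernel of `expHom x i₀`: the conjugates of the basis elements
other than `x i₀` by the powers of `x i₀`. -/
noncomputable def kernelHom : FreeGroup (KernelIndex i₀) →* F :=
  FreeGroup.lift fun s => x i₀ ^ s.2 * x s.1 * (x i₀ ^ s.2)⁻¹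

@[simp] theorem kernelHom_of (s : KernelIndex i₀) :
    kernelHom x i₀ (FreeGroup.of s) = x i₀ ^ s.2 * x s.1 * (x i₀ ^ s.2)⁻¹ := by
  simp [kernelHom]

theorem expHom_kernelHom (k : FreeGroup (KernelIndex i₀)) : expHom x i₀ (kernelHom x i₀ k) = 1 := by
  have h : (expHom x i₀).comp (kernelHom x i₀) = 1 := by
    ext s
    simp [expHom_basis_of_ne x i₀ s.1.2]
  exact DFunLike.congr_fun h k

/-- The action of `ℤ` on the free group on `KernelIndex i₀` that corresponds to conjugation by the
powers of `x i₀`. -/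
def shiftAut : Multiplicative ℤ →* MulAut (FreeGroup (KernelIndex i₀)) where
  toFun c := FreeGroup.freeGroupCongr (shiftHom _ c)
  map_one' := by
    rw [map_one]
    exact FreeGroup.freeGroupCongr_refl
  map_mul' a b := by
    rw [map_mul]
    exact (FreeGroup.freeGroupCongr_trans (shiftHom _ b) (shiftHom _ a)).symm

@[simp] theorem shiftAut_of (c : Multiplicative ℤ) (s : KernelIndex i₀) :
    shiftAut i₀ c (FreeGroup.of s) = FreeGroup.of (s.1, s.2 + c.toAdd) := by
  simp [shiftAut]

open Classical in
/-- The decomposition of `F` as a semidirect product of a free group by `ℤ`. -/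
noncomputable def toSemidirect :
    F →* FreeGroup (KernelIndex i₀) ⋊[shiftAut i₀] Multiplicative ℤ :=
  x.lift fun i => if h : i = i₀ then SemidirectProduct.inr (Multiplicative.ofAdd 1)
    else SemidirectProduct.inl (FreeGroup.of (⟨i, h⟩, 0))

theorem toSemidirect_basis_self :
    toSemidirect x i₀ (x i₀) = SemidirectProduct.inr (Multiplicative.ofAdd 1) := by
  simp [toSemidirect]

theorem toSemidirect_basis_of_ne {i : I} (h : i ≠ i₀) :
    toSemidirect x i₀ (x i) = SemidirectProduct.inl (FreeGroup.of (⟨i, h⟩, 0)) := by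
  simp [toSemidirect, h]

theorem toSemidirect_kernelHom (k : FreeGroup (KernelIndex i₀)) :
    toSemidirect x i₀ (kernelHom x i₀ k) = SemidirectProduct.inl k := by
  have h : (toSemidirect x i₀).comp (kernelHom x i₀) = SemidirectProduct.inl := by
    refine FreeGroup.ext_hom _ _ fun s => ?_
    have hn : Multiplicative.ofAdd (1 : ℤ) ^ s.2 = Multiplicative.ofAdd s.2 := by
      rw [← ofAdd_zsmul, smul_eq_mul, mul_one]
    rw [MonoidHom.comp_apply, kernelHom_of, map_mul, map_mul, map_inv, map_zpow,
      toSemidirect_basis_self, toSemidirect_basis_of_ne x i₀ s.1.2, ← map_zpow, hn, ← map_inv,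
      ← SemidirectProduct.inl_aut, shiftAut_of]
    simp
  exact DFunLike.congr_fun h k

theorem kernelHom_injective : Function.Injective (kernelHom x i₀) := fun k l h =>
  SemidirectProduct.inl_injective (φ := shiftAut i₀) (by
    rw [← toSemidirect_kernelHom x, h, toSemidirect_kernelHom])

theorem exists_kernelHom_mul_zpow (f : F) :
    ∃ k, f = kernelHom x i₀ k * x i₀ ^ (expHom x i₀ f).toAdd := by
  let γ : FreeGroup (KernelIndex i₀) ⋊[shiftAut i₀] Multiplicative ℤ →* F :=
    SemidirectProduct.lift (kernelHom x i₀) (zpowersHom F (x i₀)) fun c => by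
      refine FreeGroup.ext_hom _ _ fun s => ?_
      simp only [MonoidHom.comp_apply, MulEquiv.coe_toMonoidHom, shiftAut_of, kernelHom_of,
        MulAut.conj_apply, zpowersHom_apply]
      rw [add_comm, zpow_add]
      group
  have hγ : γ.comp (toSemidirect x i₀) = MonoidHom.id F := by
    refine x.ext_hom _ _ fun i => ?_
    by_cases h : i = i₀
    · subst h
      simp [γ, toSemidirect_basis_self]
    · simp [γ, toSemidirect_basis_of_ne x i₀ h]
  have hf : f = kernelHom x i₀ (toSemidirect x i₀ f).left *
      x i₀ ^ (toSemidirect x i₀ f).right.toAdd := by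
    have h := DFunLike.congr_fun hγ f
    exact h.symm
  have hexp : (expHom x i₀ f).toAdd = (toSemidirect x i₀ f).right.toAdd := by
    conv_lhs => rw [hf]
    rw [map_mul, expHom_kernelHom, one_mul, map_zpow, expHom_basis_self, ← ofAdd_zsmul,
      toAdd_ofAdd, smul_eq_mul, mul_one]
  exact ⟨_, by rw [hexp]; exact hf⟩

/-! ### The order on the whole free group -/

/-- An endomorphism of `F` that maps the free generators of the kernel to conjugates of free
generators, permuted by a strictly monotone permutation `π`, preserves positivity. The element
`g` in the hypothesis need not lie in the kernel: its image under `expHom` accounts for the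
shift in `π s`. -/
theorem exists_isPos_kernelHom_eq [LinearOrder (KernelIndex i₀)]
    {π : Equiv.Perm (KernelIndex i₀)} (hπ : StrictMono π) (θ : F →* F)
    (hθ : ∀ s, ∃ g : F, (expHom x i₀ g).toAdd = (π s).2 ∧
      θ (kernelHom x i₀ (FreeGroup.of s)) = g * x (π s).1 * g⁻¹)
    {k : FreeGroup (KernelIndex i₀)} (hk : NCSeries.IsPos k) :
    ∃ l, NCSeries.IsPos l ∧ kernelHom x i₀ l = θ (kernelHom x i₀ k) := by
  choose g hg hθg using hθ
  choose c hc using exists_kernelHom_mul_zpow x i₀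
  let α : FreeGroup (KernelIndex i₀) →* FreeGroup (KernelIndex i₀) :=
    FreeGroup.lift fun s => c (g s) * FreeGroup.of (π s) * (c (g s))⁻¹
  have hα : (kernelHom x i₀).comp α = θ.comp (kernelHom x i₀) := by
    refine FreeGroup.ext_hom _ _ fun s => ?_
    have h := hc (g s)
    rw [hg] at h
    rw [MonoidHom.comp_apply, MonoidHom.comp_apply, hθg]
    conv_rhs => rw [h]
    simp [α, mul_assoc]
  exact ⟨α k, hk.map hπ (c := fun s => c (g s)) (fun s => by simp [α]), DFunLike.congr_fun hα k⟩

/-- The positive cone of `F`: the elements of positive image under `expHom`, and the positive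
elements of the kernel. -/
def IsPosIn [LinearOrder (KernelIndex i₀)] (f : F) : Prop :=
  0 < expCount x i₀ f ∨
    expCount x i₀ f = 0 ∧ ∃ k, NCSeries.IsPos k ∧ kernelHom x i₀ k = f

theorem expCount_mul (f g : F) : expCount x i₀ (f * g) = expCount x i₀ f + expCount x i₀ g := by
  simp [expCount]

theorem expCount_inv (f : F) : expCount x i₀ f⁻¹ = -expCount x i₀ f := by
  simp [expCount]

variable {x i₀} [LinearOrder (KernelIndex i₀)]

theorem not_isPosIn_one : ¬ IsPosIn x i₀ 1 := by
  rintro (h | ⟨-, k, hk, h⟩)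
  · simp [expCount] at h
  · rw [map_eq_one_iff _ (kernelHom_injective x i₀)] at h
    exact NCSeries.not_isPos_one (h ▸ hk)

theorem IsPosIn.mul {f g : F} (hf : IsPosIn x i₀ f) (hg : IsPosIn x i₀ g) :
    IsPosIn x i₀ (f * g) := by
  rw [IsPosIn, expCount_mul]
  rcases hf with hf | ⟨hf, k, hk, rfl⟩ <;> rcases hg with hg | ⟨hg, l, hl, rfl⟩
  · exact Or.inl (add_pos hf hg)
  · exact Or.inl (by lia)
  · exact Or.inl (by lia)
  · exact Or.inr ⟨by lia, k * l, hk.mul hl, map_mul _ _ _⟩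

theorem isPosIn_or_isPosIn_inv {f : F} (hf : f ≠ 1) : IsPosIn x i₀ f ∨ IsPosIn x i₀ f⁻¹ := by
  unfold IsPosIn
  rw [expCount_inv]
  rcases lt_trichotomy (expCount x i₀ f) 0 with h | h | h
  · exact Or.inr (Or.inl (by lia))
  · obtain ⟨k, hk⟩ := exists_kernelHom_mul_zpow x i₀ f
    have h' : (expHom x i₀ f).toAdd = 0 := h
    rw [h', zpow_zero, mul_one] at hk
    have hk1 : k ≠ 1 := by
      rintro rfl
      exact hf (by rw [hk, map_one])
    refine (NCSeries.isPos_or_isPos_inv hk1).imp (fun hp => Or.inr ⟨h, k, hp, hk.symm⟩)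
      fun hp => Or.inr ⟨by rw [h, neg_zero], k⁻¹, hp, ?_⟩
    rw [map_inv, ← hk]
  · exact Or.inl (Or.inl h)

theorem IsPosIn.map {π : Equiv.Perm (KernelIndex i₀)} (hπ : StrictMono π) {θ : F →* F}
    (hexp : ∀ f, expCount x i₀ (θ f) = expCount x i₀ f)
    (hθ : ∀ s, ∃ g : F, expCount x i₀ g = (π s).2 ∧
      θ (kernelHom x i₀ (FreeGroup.of s)) = g * x (π s).1 * g⁻¹)
    {f : F} (hf : IsPosIn x i₀ f) : IsPosIn x i₀ (θ f) := by
  rw [IsPosIn, hexp]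
  refine hf.imp_right fun ⟨h, k, hk, hkf⟩ => ⟨h, ?_⟩
  rw [← hkf]
  exact exists_isPos_kernelHom_eq x i₀ hπ θ hθ hk

theorem IsPosIn.conj (hshift : ∀ c, StrictMono (shiftHom {j : I // j ≠ i₀} c)) {f : F}
    (hf : IsPosIn x i₀ f) (g : F) : IsPosIn x i₀ (g * f * g⁻¹) := by
  refine IsPosIn.map (hshift (expHom x i₀ g)) (θ := (MulAut.conj g).toMonoidHom)
    (fun f => ?_) (fun s => ⟨g * x i₀ ^ s.2, ?_, ?_⟩) hf
  · simp [expCount]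
  · simp [expCount, expHom_basis_self, add_comm]
  · simp [mul_assoc]

/-- The bi-ordering with positive cone `IsPosIn`. -/
theorem isBiOrdering_isPosIn (hshift : ∀ c, StrictMono (shiftHom {j : I // j ≠ i₀} c)) :
    IsBiOrdering fun f g : F => IsPosIn x i₀ (f⁻¹ * g) where
  isStrictTotalOrder :=
    { trichotomous := fun f g h1 h2 => by
        by_contra hne
        have h := isPosIn_or_isPosIn_inv (x := x) (i₀ := i₀)
          (f := f⁻¹ * g) (by rwa [ne_eq, inv_mul_eq_one])
        rw [mul_inv_rev, inv_inv] at h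
        exact h.elim h1 h2
      irrefl := fun f => by
        rw [inv_mul_cancel]
        exact not_isPosIn_one
      trans := fun f g h h1 h2 => by
        have := h1.mul h2
        rwa [mul_assoc, mul_inv_cancel_left] at this }
  mul_left f g h hfg := by
    rwa [mul_inv_rev, mul_assoc, inv_mul_cancel_left]
  mul_right f g h hfg := by
    have := hfg.conj hshift h⁻¹
    simpa [mul_assoc] using this

end Kernel

theorem theoremT {I F : Type*} [Group F] (x : FreeGroupBasis I F)
    (φ : F ≃* F) (σ : Equiv.Perm I) (w : I → F)
    (hφ : ∀ i : I, φ (x i) = w i * x (σ i) * (w i)⁻¹)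
    (i₀ : I) (hi₀ : σ i₀ = i₀)
    (hgcd : ∀ (i : I) (hfin : (permOrbit σ i).Finite),
      Int.gcd (hfin.toFinset.card : ℤ) (∑ j ∈ hfin.toFinset, expCount x i₀ (w j)) = 1) :
    ∃ lt : F → F → Prop, IsBiOrdering lt ∧ IsInvariantUnder lt φ := by
  obtain ⟨_, hshift, hskew⟩ := exists_linearOrder_skewPerm σ (fun j => expCount x i₀ (w j)) hgcd
  -- the order on `I × ℤ` is restricted to the generators of the kernel
  let ι : KernelIndex i₀ → I × ℤ := Prod.map Subtype.val id
  let _ : LinearOrder (KernelIndex i₀) :=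
    LinearOrder.lift' ι (Subtype.val_injective.prodMap Function.injective_id)
  have hσ (i : I) : σ i ≠ i₀ ↔ i ≠ i₀ := by
    rw [ne_eq, ne_eq, ← σ.injective.eq_iff (a := i), hi₀]
  let π : Equiv.Perm (KernelIndex i₀) :=
    skewPerm (σ.subtypePerm hσ) fun j => expCount x i₀ (w j)
  have hπ : StrictMono π := fun s t hst => hskew (a := ι s) (b := ι t) hst
  have hshift' (c : Multiplicative ℤ) : StrictMono (shiftHom {j : I // j ≠ i₀} c) :=
    fun s t hst => hshift c (a := ι s) (b := ι t) hst
  have hexpHom : (expHom x i₀).comp φ.toMonoidHom = expHom x i₀ := by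
    refine x.ext_hom _ _ fun i => ?_
    have h : expHom x i₀ (φ (x i)) = expHom x i₀ (x (σ i)) := by
      rw [hφ, map_mul, map_mul, map_inv, mul_inv_cancel_comm]
    refine h.trans ?_
    by_cases hi : i = i₀
    · rw [hi, hi₀]
    · rw [expHom_basis_of_ne x i₀ hi, expHom_basis_of_ne x i₀ ((hσ i).2 hi)]
  have hexp (f : F) : expCount x i₀ (φ f) = expCount x i₀ f :=
    congrArg Multiplicative.toAdd (DFunLike.congr_fun hexpHom f)
  have hpos {f : F} (hf : IsPosIn x i₀ f) : IsPosIn x i₀ (φ f) := by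
    refine IsPosIn.map hπ (θ := φ.toMonoidHom) hexp
      (fun s => ⟨φ (x i₀) ^ s.2 * w s.1, ?_, ?_⟩) hf
    · have h0 : expHom x i₀ (φ (x i₀)) = Multiplicative.ofAdd 1 := by
        rw [← expHom_basis_self x i₀]
        exact DFunLike.congr_fun hexpHom (x i₀)
      simp [expCount, π, h0]
    · have h1 : φ (kernelHom x i₀ (FreeGroup.of s)) =
          φ (x i₀) ^ s.2 * (w s.1 * x (σ s.1) * (w s.1)⁻¹) * (φ (x i₀) ^ s.2)⁻¹ := by
        rw [kernelHom_of, map_mul, map_mul, map_inv, map_zpow, hφ s.1]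
      refine h1.trans ?_
      simp [π, mul_assoc]
  refine ⟨_, isBiOrdering_isPosIn (x := x) hshift', fun f g => ?_⟩
  have e : (φ f)⁻¹ * φ g = φ (f⁻¹ * g) := by rw [map_mul, map_inv]
  change IsPosIn x i₀ (f⁻¹ * g) ↔ IsPosIn x i₀ ((φ f)⁻¹ * φ g)
  rw [e]
  refine ⟨hpos, fun h => ?_⟩
  -- a nonpositive element would be trivial or have a positive inverse
  by_contra hn
  rcases eq_or_ne (f⁻¹ * g) 1 with h1 | h1
  · rw [h1, map_one] at h
    exact not_isPosIn_one h
  · have h2 := h.mul (hpos ((isPosIn_or_isPosIn_inv h1).resolve_left hn))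
    rw [map_inv, mul_inv_cancel] at h2
    exact not_isPosIn_one h2
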